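/- Let $f\colon X\to Y$ be a map between Kan complexes (fibrant simplicial sets) which is a weak equivalence, i.e. it induces a bijection $\pi_0(X)\to\pi_0(Y)$ and isomorphisms $\pi_m(X,x)\to\pi_m(Y,f(x))$ for all $m\ge 1$ and all vertices $x\in X_0$. Here $\pi_m(K,x)$ denotes the set of maps $\Delta^m\to K$ that are constant at $x$ on $\partial\Delta^m$, modulo the equivalence relation generated by simplicial homotopy relative to $\partial\Delta^m$. Then, for every $n\ge 0$, $f$ has the relative-homotopy-lifting property (RHLP) with respect to the inclusion $\partial\Delta^n\hookrightarrow\Delta^n$: for all maps $g\colon\partial\Delta^n\to X$ and $h\colon\Delta^n\to Y$ with $f\circ g=h|_{\partial\Delta^n}$, there exist a map $l\colon\Delta^n\to X$ with $l|_{\partial\Delta^n}=g$ and a simplicial homotopy $H\colon\Delta^n\times\Delta^1\to Y$ from $f\circ l$ to $h$ which is constant on $\partial\Delta^n$, i.e. whose restriction to $\partial\Delta^n\times\Delta^1$ is the projection to $\partial\Delta^n$ followed by $f\circ g$. -/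

import Mathlib

open CategoryTheory Simplicial MonoidalCategory CartesianMonoidalCategory

universe u

namespace SSet

/-- A relative-homotopy-lifting of the square with top `g : K ⟶ X`, left `i : K ⟶ L`,
right `f : X ⟶ Y` and bottom `h : L ⟶ Y`: a map `lift : L ⟶ X` under `K`, together with a
simplicial homotopy relative to `K` from `lift ≫ f` to `h`. -/
structure RelHomotopyLifting {K L X Y : SSet.{u}} (i : K ⟶ L) (f : X ⟶ Y)
    (g : K ⟶ X) (h : L ⟶ Y) where
  lift : L ⟶ X
  fac : i ≫ lift = g
  homotopy : L ⊗ Δ[1] ⟶ Y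
  homotopy_zero : ι₀ ≫ homotopy = lift ≫ f
  homotopy_one : ι₁ ≫ homotopy = h
  /-- The homotopy is constant on `K`. -/
  homotopy_rel : i ▷ Δ[1] ≫ homotopy = fst K Δ[1] ≫ i ≫ h

/-- The relative-homotopy-lifting property (RHLP) of `f : X ⟶ Y` with respect to
`i : K ⟶ L`: every commutative square from `i` to `f` has a relative-homotopy-lifting. -/
def HasRHLP {K L X Y : SSet.{u}} (i : K ⟶ L) (f : X ⟶ Y) : Prop :=
  ∀ (g : K ⟶ X) (h : L ⟶ Y), g ≫ f = i ≫ h → Nonempty (RelHomotopyLifting i f g h)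

/-- The underlying set of `π_n(X, x)`: maps `Δ[n] ⟶ X` which are constant with value `x` on
`∂Δ[n]`, modulo the equivalence relation generated by simplicial homotopy relative to
`∂Δ[n]`. -/
def HomotopyGroup (n : ℕ) (X : SSet.{u}) (x : X _⦋0⦌) : Type u :=
  RelativeMorphism.HomotopyClass (boundary n) (Subcomplex.ofSimplex x)
    (const ⟨x, Subcomplex.mem_ofSimplex_obj x⟩)

/-- The map `π_n(X, x) → π_n(Y, f x)` induced by `f : X ⟶ Y`, sending the class of `s` to the
class of `s ≫ f`. -/
def HomotopyGroup.map (n : ℕ) {X Y : SSet.{u}} (f : X ⟶ Y) (x : X _⦋0⦌) :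
    HomotopyGroup n X x → HomotopyGroup n Y (f.app _ x) :=
  fun s => RelativeMorphism.HomotopyClass.postcomp s
    (RelativeMorphism.ofSimplex₀ f x (f.app _ x) rfl) rfl

/-- A map of simplicial sets (between Kan complexes) is a weak equivalence if it induces a
bijection on `π₀` and isomorphisms on `π_n`, for all `n ≥ 1` and all basepoints of the source.
(Induced maps on homotopy groups are homomorphisms, so they are isomorphisms exactly when they
are bijective.) -/
structure IsHomotopyGroupEquiv {X Y : SSet.{u}} (f : X ⟶ Y) : Prop where
  bijective_π₀ : Function.Bijective (mapπ₀ f)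
  bijective_map : ∀ (n : ℕ), 1 ≤ n → ∀ (x : X _⦋0⦌),
    Function.Bijective (HomotopyGroup.map n f x)

end SSet

/-! Relative homotopy lifting is invariant under homotopies of squares when both complexes are Kan
(`nonempty_relHomotopyLifting_of_homotopy`), so a square may be deformed until its top map is
constant. In that case the lifting is exactly surjectivity on homotopy classes
(`nonempty_relHomotopyLifting_of_const`).

To make the top map `g` on `∂Δ[n + 1]` constant, two deformations suffice. The last horn contracts
to its last vertex `v`, so by homotopy extension `g` becomes constant on that horn. What remains is
the face opposite `v`, an element of `π_n(X, x)`; its image under `f` is trivial because the bottom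
map fills it, so injectivity on `π_n` gives a null homotopy, which glues with the constant homotopy
on the horn. Surjectivity on `π_{n+1}` then concludes. -/

namespace SSet

open HomotopicalAlgebra modelCategoryQuillen Limits Opposite

variable {K L X Y : SSet.{u}}

/-! ### Homotopy extension, composition and cancellation in Kan complexes -/

/-- The lifting property of a Kan complex with respect to the pushout-product of a monomorphism
and an anodyne extension. -/
lemma exists_extension_tensor_of_anodyne {A B : SSet.{u}} (i : K ⟶ L) [Mono i] {j : A ⟶ B}
    (hj : anodyneExtensions j) [KanComplex Y] (a : L ⊗ A ⟶ Y) (b : K ⊗ B ⟶ Y)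
    (h : i ▷ A ≫ a = K ◁ j ≫ b) :
    ∃ c : L ⊗ B ⟶ Y, L ◁ j ≫ c = a ∧ i ▷ B ≫ c = b := by
  -- Restriction along `i` between internal homs into `Y` is a fibration, so the transposed lifting
  -- problem against `j` is solvable.
  have := hj ((MonoidalClosed.pre i).app Y) ((fibration_iff _).1 inferInstance)
  have sq : CommSq (MonoidalClosed.curry a) j ((MonoidalClosed.pre i).app Y)
      (MonoidalClosed.curry b) := ⟨by
    rw [MonoidalClosed.curry_pre_app, h, MonoidalClosed.curry_natural_left]⟩
  refine ⟨MonoidalClosed.uncurry sq.lift, ?_, ?_⟩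
  · rw [← MonoidalClosed.uncurry_natural_left, sq.fac_left, MonoidalClosed.uncurry_curry]
  · apply MonoidalClosed.curry_injective
    rw [← MonoidalClosed.curry_pre_app, MonoidalClosed.curry_uncurry, sq.fac_right]

lemma horn_one_zero_ι : Λ[1, 0].ι = const (stdSimplex.obj₀Equiv.{u}.symm 0) :=
  horn.hom_ext' (fun j hj ↦ by
    obtain rfl : j = 1 := Fin.eq_one_of_ne_zero j hj
    rw [horn.ι_ι, stdSimplex.δ_one_eq_const, comp_const])

lemma horn_one_one_ι : Λ[1, 1].ι = const (stdSimplex.obj₀Equiv.{u}.symm 1) :=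
  horn.hom_ext' (fun j hj ↦ by
    obtain rfl : j = 0 := by fin_cases j <;> simp_all
    rw [horn.ι_ι, stdSimplex.δ_zero_eq_const, comp_const])

/-- The homotopy extension property, for a homotopy with prescribed source. -/
lemma exists_homotopy_extension₀ (i : K ⟶ L) [Mono i] [KanComplex Y] (a : L ⟶ Y)
    (G : K ⊗ Δ[1] ⟶ Y) (h : ι₀ ≫ G = i ≫ a) :
    ∃ H : L ⊗ Δ[1] ⟶ Y, ι₀ ≫ H = a ∧ i ▷ Δ[1] ≫ H = G := by
  have e (Z : SSet.{u}) : Z ◁ Λ[1, 0].ι = fst _ _ ≫ ι₀ := by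
    rw [horn_one_zero_ι]; rfl
  obtain ⟨H, h₁, h₂⟩ := exists_extension_tensor_of_anodyne i
    (anodyneExtensions.horn_ι (0 : Fin 2)) (fst _ _ ≫ a) G (by
      rw [e, Category.assoc, h, whiskerRight_fst_assoc])
  refine ⟨H, ?_, h₂⟩
  -- The horn is a single vertex, and `s` is the section of the projection at that vertex.
  let s : L ⟶ L ⊗ (Λ[1, 0] : SSet) := lift (𝟙 L) (const ⟨stdSimplex.obj₀Equiv.symm 0, by
    rw [mem_horn_iff_notMem_range]; exact ⟨1, by simp, by rintro ⟨_, h⟩; cases h⟩⟩)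
  have hs : s ≫ L ◁ Λ[1, 0].ι = ι₀ := rfl
  rw [← hs, Category.assoc, h₁]
  rfl

/-- The homotopy extension property, for a homotopy with prescribed target. -/
lemma exists_homotopy_extension₁ (i : K ⟶ L) [Mono i] [KanComplex Y] (a : L ⟶ Y)
    (G : K ⊗ Δ[1] ⟶ Y) (h : ι₁ ≫ G = i ≫ a) :
    ∃ H : L ⊗ Δ[1] ⟶ Y, ι₁ ≫ H = a ∧ i ▷ Δ[1] ≫ H = G := by
  have e (Z : SSet.{u}) : Z ◁ Λ[1, 1].ι = fst _ _ ≫ ι₁ := by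
    rw [horn_one_one_ι]; rfl
  obtain ⟨H, h₁, h₂⟩ := exists_extension_tensor_of_anodyne i
    (anodyneExtensions.horn_ι (1 : Fin 2)) (fst _ _ ≫ a) G (by
      rw [e, Category.assoc, h, whiskerRight_fst_assoc])
  refine ⟨H, ?_, h₂⟩
  let s : L ⟶ L ⊗ (Λ[1, 1] : SSet) := lift (𝟙 L) (const ⟨stdSimplex.obj₀Equiv.symm 1, by
    rw [mem_horn_iff_notMem_range]; exact ⟨0, by simp, by rintro ⟨_, h⟩; cases h⟩⟩)
  have hs : s ≫ L ◁ Λ[1, 1].ι = ι₁ := rfl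
  rw [← hs, Category.assoc, h₁]
  rfl

lemma whiskerLeft_δ_zero (Z : SSet.{u}) :
    Z ◁ stdSimplex.{u}.δ (0 : Fin 2) = fst _ _ ≫ ι₁ := by
  rw [stdSimplex.δ_zero_eq_const]; rfl

lemma whiskerLeft_δ_one (Z : SSet.{u}) :
    Z ◁ stdSimplex.{u}.δ (1 : Fin 2) = fst _ _ ≫ ι₀ := by
  rw [stdSimplex.δ_one_eq_const]; rfl

lemma ι₀_whiskerLeft {Z : SSet.{u}} (g : Δ[1] ⟶ Z) :
    ι₀ ≫ L ◁ g = lift (𝟙 L) (const (g.app _ (stdSimplex.obj₀Equiv.symm 0))) := by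
  rw [← const_comp]; rfl

lemma ι₁_whiskerLeft {Z : SSet.{u}} (g : Δ[1] ⟶ Z) :
    ι₁ ≫ L ◁ g = lift (𝟙 L) (const (g.app _ (stdSimplex.obj₀Equiv.symm 1))) := by
  rw [← const_comp]; rfl

lemma ι₀_δ_one : (ι₀ : L ⟶ _) ≫ L ◁ stdSimplex.{u}.δ (1 : Fin 3) =
    ι₀ ≫ L ◁ stdSimplex.{u}.δ (2 : Fin 3) := by
  rw [ι₀_whiskerLeft, ι₀_whiskerLeft]
  congr 2

lemma ι₁_δ_one : (ι₁ : L ⟶ _) ≫ L ◁ stdSimplex.{u}.δ (1 : Fin 3) =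
    ι₁ ≫ L ◁ stdSimplex.{u}.δ (0 : Fin 3) := by
  rw [ι₁_whiskerLeft, ι₁_whiskerLeft]
  congr 2

lemma ι₁_δ_two : (ι₁ : L ⟶ _) ≫ L ◁ stdSimplex.{u}.δ (2 : Fin 3) =
    ι₀ ≫ L ◁ stdSimplex.{u}.δ (0 : Fin 3) := by
  rw [ι₁_whiskerLeft, ι₀_whiskerLeft]
  congr 2

/-- Composition of homotopies, over a given triangle of homotopies on `K`. -/
lemma exists_homotopy_comp (i : K ⟶ L) [Mono i] [KanComplex Y] (a b : L ⊗ Δ[1] ⟶ Y)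
    (hab : ι₁ ≫ a = ι₀ ≫ b) (T : K ⊗ Δ[2] ⟶ Y)
    (ha : K ◁ stdSimplex.δ 2 ≫ T = i ▷ Δ[1] ≫ a)
    (hb : K ◁ stdSimplex.δ 0 ≫ T = i ▷ Δ[1] ≫ b) :
    ∃ c : L ⊗ Δ[1] ⟶ Y, ι₀ ≫ c = ι₀ ≫ a ∧ ι₁ ≫ c = ι₁ ≫ b ∧
      i ▷ Δ[1] ≫ c = K ◁ stdSimplex.δ 1 ≫ T := by
  have po (Z : SSet.{u}) := horn₂₁.isPushout.{u}.map (tensorLeft Z)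
  -- Tensoring with `L` preserves the gluing of two edges into a horn, so `a` and `b` define a map
  -- on `L ⊗ Λ[2, 1]`. The third edge of a filler extending `T` is the composite.
  obtain ⟨u, hu₁, hu₂⟩ := (po L).exists_desc a b (by
    simp [whiskerLeft_δ_zero, whiskerLeft_δ_one, hab])
  dsimp at hu₁ hu₂
  obtain ⟨w, hw₁, hw₂⟩ := exists_extension_tensor_of_anodyne i
    (anodyneExtensions.horn_ι (1 : Fin 3)) u T (by
      apply (po K).hom_ext
      · dsimp
        rw [whisker_exchange_assoc, hu₁, ← ha, ← MonoidalCategory.whiskerLeft_comp_assoc,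
          horn.ι_ι]
      · dsimp
        rw [whisker_exchange_assoc, hu₂, ← hb, ← MonoidalCategory.whiskerLeft_comp_assoc,
          horn.ι_ι])
  have ea : L ◁ stdSimplex.δ 2 ≫ w = a := by
    rw [← hu₁, ← hw₁, ← MonoidalCategory.whiskerLeft_comp_assoc, horn.ι_ι]
  have eb : L ◁ stdSimplex.δ 0 ≫ w = b := by
    rw [← hu₂, ← hw₁, ← MonoidalCategory.whiskerLeft_comp_assoc, horn.ι_ι]
  refine ⟨L ◁ stdSimplex.δ 1 ≫ w, ?_, ?_, ?_⟩
  · rw [← ea, ← Category.assoc, ι₀_δ_one, Category.assoc]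
  · rw [← eb, ← Category.assoc, ι₁_δ_one, Category.assoc]
  · rw [← hw₂]
    exact (whisker_exchange_assoc i (stdSimplex.δ 1) w).symm

/-- Right cancellation of homotopies, over a given triangle of homotopies on `K`. -/
lemma exists_homotopy_cancel (i : K ⟶ L) [Mono i] [KanComplex Y] (c b : L ⊗ Δ[1] ⟶ Y)
    (hcb : ι₁ ≫ c = ι₁ ≫ b) (T : K ⊗ Δ[2] ⟶ Y)
    (hc : K ◁ stdSimplex.δ 1 ≫ T = i ▷ Δ[1] ≫ c)
    (hb : K ◁ stdSimplex.δ 0 ≫ T = i ▷ Δ[1] ≫ b) :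
    ∃ a : L ⊗ Δ[1] ⟶ Y, ι₀ ≫ a = ι₀ ≫ c ∧ ι₁ ≫ a = ι₀ ≫ b ∧
      i ▷ Δ[1] ≫ a = K ◁ stdSimplex.δ 2 ≫ T := by
  have po (Z : SSet.{u}) := horn₂₂.isPushout.{u}.map (tensorLeft Z)
  obtain ⟨u, hu₁, hu₂⟩ := (po L).exists_desc c b (by
    simp [whiskerLeft_δ_zero, hcb])
  dsimp at hu₁ hu₂
  obtain ⟨w, hw₁, hw₂⟩ := exists_extension_tensor_of_anodyne i
    (anodyneExtensions.horn_ι (2 : Fin 3)) u T (by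
      apply (po K).hom_ext
      · dsimp
        rw [whisker_exchange_assoc, hu₁, ← hc, ← MonoidalCategory.whiskerLeft_comp_assoc,
          horn.ι_ι]
      · dsimp
        rw [whisker_exchange_assoc, hu₂, ← hb, ← MonoidalCategory.whiskerLeft_comp_assoc,
          horn.ι_ι])
  have ec : L ◁ stdSimplex.δ 1 ≫ w = c := by
    rw [← hu₁, ← hw₁, ← MonoidalCategory.whiskerLeft_comp_assoc, horn.ι_ι]
  have eb : L ◁ stdSimplex.δ 0 ≫ w = b := by
    rw [← hu₂, ← hw₁, ← MonoidalCategory.whiskerLeft_comp_assoc, horn.ι_ι]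
  refine ⟨L ◁ stdSimplex.δ 2 ≫ w, ?_, ?_, ?_⟩
  · rw [← ec, ← Category.assoc, ← ι₀_δ_one, Category.assoc]
  · rw [← eb, ← Category.assoc, ι₁_δ_two, Category.assoc]
  · rw [← hw₂]
    exact (whisker_exchange_assoc i (stdSimplex.δ 2) w).symm

/-- Homotopies relative to `K` can be composed. -/
lemma exists_relHomotopy_trans (i : K ⟶ L) [Mono i] [KanComplex Y] (r : K ⟶ Y)
    (a b : L ⊗ Δ[1] ⟶ Y) (hab : ι₁ ≫ a = ι₀ ≫ b)
    (ha : i ▷ Δ[1] ≫ a = fst _ _ ≫ r) (hb : i ▷ Δ[1] ≫ b = fst _ _ ≫ r) :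
    ∃ c : L ⊗ Δ[1] ⟶ Y, ι₀ ≫ c = ι₀ ≫ a ∧ ι₁ ≫ c = ι₁ ≫ b ∧
      i ▷ Δ[1] ≫ c = fst _ _ ≫ r := by
  obtain ⟨c, h₀, h₁, h₂⟩ := exists_homotopy_comp i a b hab (fst _ _ ≫ r)
    ((whiskerLeft_fst_assoc K (stdSimplex.δ 2) r).trans ha.symm)
    ((whiskerLeft_fst_assoc K (stdSimplex.δ 0) r).trans hb.symm)
  exact ⟨c, h₀, h₁, h₂.trans (whiskerLeft_fst_assoc K (stdSimplex.δ 1) r)⟩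

/-- Homotopies relative to `K` can be reversed. -/
lemma exists_relHomotopy_symm (i : K ⟶ L) [Mono i] [KanComplex Y] (r : K ⟶ Y)
    (a : L ⊗ Δ[1] ⟶ Y) (ha : i ▷ Δ[1] ≫ a = fst _ _ ≫ r) :
    ∃ c : L ⊗ Δ[1] ⟶ Y, ι₀ ≫ c = ι₁ ≫ a ∧ ι₁ ≫ c = ι₀ ≫ a ∧
      i ▷ Δ[1] ≫ c = fst _ _ ≫ r := by
  have hr : i ≫ ι₁ ≫ a = r := by
    have := (ι₁ : K ⟶ _) ≫= ha
    rwa [ι₁_comp_assoc, ← Category.assoc _ (fst _ _), show ι₁ ≫ fst K Δ[1] = 𝟙 K from rfl,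
      Category.id_comp] at this
  -- Cancelling `a` from the constant homotopy at its end leaves an inverse of `a`.
  obtain ⟨c, h₀, h₁, h₂⟩ := exists_homotopy_cancel i (fst _ _ ≫ ι₁ ≫ a) a
    (by rw [← Category.assoc, show ι₁ ≫ fst L Δ[1] = 𝟙 L from rfl, Category.id_comp])
    (fst _ _ ≫ r)
    ((whiskerLeft_fst_assoc K (stdSimplex.δ 1) r).trans (by rw [whiskerRight_fst_assoc, hr]))
    ((whiskerLeft_fst_assoc K (stdSimplex.δ 0) r).trans ha.symm)
  refine ⟨c, ?_, h₁, h₂.trans (whiskerLeft_fst_assoc K (stdSimplex.δ 2) r)⟩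
  rw [h₀, ← Category.assoc, show ι₀ ≫ fst L Δ[1] = 𝟙 L from rfl, Category.id_comp]

/-! ### Relative homotopy is an equivalence relation -/

namespace RelativeMorphism

variable {A : X.Subcomplex} {B : Y.Subcomplex} {φ : (A : SSet) ⟶ (B : SSet)}

lemma equivalence_homotopy [KanComplex Y] :
    Equivalence (fun f g : RelativeMorphism A B φ ↦ Nonempty (Homotopy f g)) where
  refl f := ⟨.refl f⟩
  symm := by
    rintro f g ⟨h⟩
    obtain ⟨c, h₀, h₁, h₂⟩ := exists_relHomotopy_symm A.ι _ h.h h.rel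
    exact ⟨⟨c, h₀.trans h.h₁, h₁.trans h.h₀, h₂⟩⟩
  trans := by
    rintro f g k ⟨h⟩ ⟨h'⟩
    obtain ⟨c, h₀, h₁, h₂⟩ := exists_relHomotopy_trans A.ι _ h.h h'.h
      (h.h₁.trans h'.h₀.symm) h.rel h'.rel
    exact ⟨⟨c, h₀.trans h.h₀, h₁.trans h'.h₁, h₂⟩⟩

/-- When the target is a Kan complex, relative morphisms in the same homotopy class are related
by a single homotopy. -/
lemma nonempty_homotopy_of_homotopyClass_eq [KanComplex Y] {f g : RelativeMorphism A B φ}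
    (h : f.homotopyClass = g.homotopyClass) : Nonempty (Homotopy f g) :=
  equivalence_homotopy.eqvGen_iff.1 (Quot.eqvGen_exact h)

end RelativeMorphism

/-! ### Transport of liftings along homotopies of squares -/

lemma δ_two_comp_σ_zero : stdSimplex.{u}.δ (2 : Fin 3) ≫ stdSimplex.σ (0 : Fin 2) =
    const (stdSimplex.obj₀Equiv.symm 0) :=
  yonedaEquiv.injective (stdSimplex.ext _ _ (fun j ↦ by fin_cases j <;> rfl))

lemma δ_zero_comp_σ_one : stdSimplex.{u}.δ (0 : Fin 3) ≫ stdSimplex.σ (1 : Fin 2) =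
    const (stdSimplex.obj₀Equiv.symm 1) :=
  yonedaEquiv.injective (stdSimplex.ext _ _ (fun j ↦ by fin_cases j <;> rfl))

lemma whiskerLeft_δ_σ_of_eq_id {j : Fin 3} {k : Fin 2}
    (h : stdSimplex.{u}.δ j ≫ stdSimplex.σ k = 𝟙 _) (G : K ⊗ Δ[1] ⟶ Y) :
    K ◁ stdSimplex.δ j ≫ K ◁ stdSimplex.σ k ≫ G = G := by
  have : K ◁ stdSimplex.δ j ≫ K ◁ stdSimplex.σ k = 𝟙 _ :=
    (MonoidalCategory.whiskerLeft_comp K _ _).symm.trans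
      ((congr_arg (K ◁ ·) h).trans (MonoidalCategory.whiskerLeft_id K _))
  exact (reassoc_of% this) G

/-- Relative homotopy liftings can be transported along a homotopy of squares. -/
lemma nonempty_relHomotopyLifting_of_homotopy (i : K ⟶ L) [Mono i] [KanComplex X] [KanComplex Y]
    (f : X ⟶ Y) (G : K ⊗ Δ[1] ⟶ X) (H : L ⊗ Δ[1] ⟶ Y) (hGH : i ▷ Δ[1] ≫ H = G ≫ f)
    (h : Nonempty (RelHomotopyLifting i f (ι₁ ≫ G) (ι₁ ≫ H))) :
    Nonempty (RelHomotopyLifting i f (ι₀ ≫ G) (ι₀ ≫ H)) := by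
  obtain ⟨l, hl, M, hM₀, hM₁, hM⟩ := h
  -- `N` carries the given lift back along `G`; its source is the new lift. The required homotopy is
  -- `N ≫ f`, then `M`, then `H` backwards. Over `K` this is `G ≫ f` followed by its reverse, and
  -- the degenerate triangles `σ 1` and `σ 0` make it constant there.
  obtain ⟨N, hN₁, hN⟩ := exists_homotopy_extension₁ i l G hl.symm
  obtain ⟨c, hc₀, hc₁, hc⟩ := exists_homotopy_comp i (N ≫ f) M
    (by rw [hM₀, ← hN₁, Category.assoc]) (K ◁ stdSimplex.σ 1 ≫ G ≫ f)
    (by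
      rw [whiskerLeft_δ_σ_of_eq_id, reassoc_of% hN]
      exact stdSimplex.{u}.δ_comp_σ_succ (i := (1 : Fin 2)))
    (by
      rw [hM, ← ι₁_comp_assoc, hGH]
      have := (congr_arg (K ◁ ·) δ_zero_comp_σ_one.{u})
      exact congr_arg (· ≫ G ≫ f) this)
  replace hc := hc.trans
    (whiskerLeft_δ_σ_of_eq_id (stdSimplex.{u}.δ_comp_σ_self (i := (1 : Fin 2))) _)
  obtain ⟨d, hd₀, hd₁, hd⟩ := exists_homotopy_cancel i c H (by rw [hc₁, hM₁])
    (K ◁ stdSimplex.σ 0 ≫ G ≫ f)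
    (by
      rw [whiskerLeft_δ_σ_of_eq_id, hc]
      exact stdSimplex.{u}.δ_comp_σ_succ (i := (0 : Fin 2)))
    (by
      rw [whiskerLeft_δ_σ_of_eq_id, hGH]
      exact stdSimplex.{u}.δ_comp_σ_self (i := (0 : Fin 2)))
  refine ⟨⟨ι₀ ≫ N, ?_, d, ?_, hd₁, ?_⟩⟩
  · rw [← ι₀_comp_assoc, hN]
  · rw [hd₀, hc₀, Category.assoc]
  · rw [hd, ← ι₀_comp_assoc, hGH]
    exact congr_arg (· ≫ G ≫ f) (congr_arg (K ◁ ·) δ_two_comp_σ_zero.{u})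

/-! ### Contraction to the last vertex, and gluing along the boundary -/

namespace stdSimplex

/-- The homotopy from the identity of `Δ[n]` to the constant map at the last vertex. -/
noncomputable def contraction (n : ℕ) : Δ[n] ⊗ Δ[1] ⟶ (Δ[n] : SSet.{u}) where
  app d := ↾fun x ↦ objMk
    { toFun k := if asOrderHom x.2 k = 0 then asOrderHom x.1 k else Fin.last n
      monotone' a b hab := by
        have h₁ := (asOrderHom x.1).monotone hab
        have h₂ := (asOrderHom x.2).monotone hab
        dsimp only
        split_ifs with ha hb hb
        · exact h₁
        · exact Fin.le_last _
        · rw [hb] at h₂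
          exact (ha (le_antisymm h₂ (Fin.zero_le _))).elim
        · exact le_rfl }
  naturality _ _ _ := rfl

lemma contraction_app_apply {n d : ℕ} (x : (Δ[n] ⊗ Δ[1] : SSet.{u}) _⦋d⦌) (k : Fin (d + 1)) :
    (contraction n).app _ x k = if x.2 k = 0 then x.1 k else Fin.last n := rfl

lemma ι₀_contraction (n : ℕ) : ι₀ ≫ contraction.{u} n = 𝟙 _ := by
  ext ⟨d⟩ x
  exact stdSimplex.ext _ _ (fun _ ↦ rfl)

lemma ι₁_contraction (n : ℕ) :
    ι₁ ≫ contraction.{u} n = SSet.const (obj₀Equiv.symm (Fin.last n)) := by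
  ext ⟨d⟩ x
  exact stdSimplex.ext _ _ (fun _ ↦ rfl)

end stdSimplex

namespace horn

/-- The horn `Λ[n + 1, last]` is stable under the contraction of `Δ[n + 1]` to its last vertex. -/
noncomputable def contraction (n : ℕ) :
    (Λ[n + 1, Fin.last _] : SSet.{u}) ⊗ Δ[1] ⟶ (Λ[n + 1, Fin.last _] : SSet.{u}) :=
  Subcomplex.lift (Λ[n + 1, Fin.last _].ι ▷ Δ[1] ≫ stdSimplex.contraction (n + 1)) (by
    rintro ⟨d⟩ _ ⟨⟨⟨x, hx⟩, t⟩, rfl⟩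
    induction d with | _ d
    rw [mem_horn_iff_notMem_range] at hx ⊢
    -- A simplex of the horn misses some vertex `j` other than the last; contracting introduces only
    -- the last vertex, so `j` is still missed.
    obtain ⟨j, hj, hx⟩ := hx
    refine ⟨j, hj, ?_⟩
    rintro ⟨k, hk⟩
    erw [stdSimplex.contraction_app_apply] at hk
    split_ifs at hk with h
    · exact hx ⟨k, hk⟩
    · exact hj hk.symm)

lemma contraction_ι (n : ℕ) : contraction.{u} n ≫ Λ[n + 1, Fin.last _].ι =
    Λ[n + 1, Fin.last _].ι ▷ Δ[1] ≫ stdSimplex.contraction (n + 1) := rfl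

/-- The boundary contains every proper subcomplex, and the horn is proper since it omits a face. -/
lemma le_boundary {n : ℕ} (i : Fin (n + 2)) : horn.{u} (n + 1) i ≤ boundary (n + 1) := by
  rw [stdSimplex.le_boundary_iff]
  rintro h
  have := (subcomplex_le_horn_iff.{u} _ i).1 (le_refl (horn.{u} (n + 1) i))
  rw [h] at this
  exact this le_top

lemma bicartSq_boundary {n : ℕ} (i : Fin (n + 2)) :
    Subcomplex.BicartSq (stdSimplex.face.{u} {i}ᶜ ⊓ Λ[n + 1, i]) (stdSimplex.face {i}ᶜ)
      Λ[n + 1, i] ∂Δ[n + 1] where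
  inf_eq := rfl
  sup_eq := by
    apply le_antisymm
    · exact sup_le (face_singleton_compl_le_boundary i) (le_boundary i)
    · rw [boundary_eq_iSup, iSup_le_iff]
      intro j
      by_cases h : j = i
      · subst h; exact le_sup_left
      · exact (face_le_horn j i h).trans le_sup_right

lemma boundary_hom_ext {n : ℕ} (i : Fin (n + 2)) {g g' : (∂Δ[n + 1] : SSet) ⟶ X}
    (h₁ : boundary.ι i ≫ g = boundary.ι i ≫ g')
    (h₂ : Subcomplex.homOfLE (le_boundary i) ≫ g = Subcomplex.homOfLE (le_boundary i) ≫ g') :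
    g = g' := by
  refine boundary.hom_ext (fun k ↦ ?_)
  by_cases hk : k = i
  · subst hk; exact h₁
  · exact horn.ι i k hk ≫= h₂

/-- The restriction `∂Δ[n] ⟶ Λ[n + 1, i]` of the `i`th face map. -/
def boundaryFace {n : ℕ} (i : Fin (n + 2)) : (∂Δ[n] : SSet.{u}) ⟶ Λ[n + 1, i] :=
  Subcomplex.lift (∂Δ[n].ι ≫ stdSimplex.δ i) (by
    rintro ⟨d⟩ _ ⟨⟨y, hy⟩, rfl⟩
    induction d with | _ d
    rw [mem_boundary_iff_notMem_range] at hy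
    rw [mem_horn_iff_notMem_range]
    obtain ⟨k, hk⟩ := hy
    refine ⟨i.succAbove k, Fin.succAbove_ne i k, ?_⟩
    rintro ⟨l, hl⟩
    exact hk ⟨l, Fin.succAbove_right_injective hl⟩)

/-- Gluing a homotopy on the `i`th face of `∂Δ[n + 1]` which is constant on the boundary of this
face and a constant homotopy on the horn `Λ[n + 1, i]`. -/
lemma exists_homotopy_boundary {n : ℕ} (i : Fin (n + 2)) (x : X _⦋0⦌)
    (A : Δ[n] ⊗ Δ[1] ⟶ X) (hA : ∂Δ[n].ι ▷ Δ[1] ≫ A = SSet.const x) :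
    ∃ G : (∂Δ[n + 1] : SSet.{u}) ⊗ Δ[1] ⟶ X, boundary.ι i ▷ Δ[1] ≫ G = A ∧
      Subcomplex.homOfLE (le_boundary i) ▷ Δ[1] ≫ G = SSet.const x := by
  have po := (bicartSq_boundary.{u} i).isPushout.map (tensorRight Δ[1])
  have hb : ∀ e : ((stdSimplex.face.{u} {i}ᶜ ⊓ Λ[n + 1, i] : Subcomplex _) : SSet) ⟶ Δ[n],
      e ≫ stdSimplex.δ i = Subcomplex.ι _ → e ▷ Δ[1] ≫ A = SSet.const x := by
    intro e he
    -- Otherwise `e` would hit the top simplex of `Δ[n]`, and the horn would contain its missing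
    -- face.
    have : Subcomplex.range e ≤ ∂Δ[n] := by
      rw [stdSimplex.le_boundary_iff]
      intro h
      have h' : stdSimplex.face.{u} {i}ᶜ ≤ Λ[n + 1, i] := by
        rw [stdSimplex.face_singleton_compl, Subcomplex.ofSimplex_le_iff]
        obtain ⟨y, hy⟩ : (stdSimplex.objEquiv.symm (𝟙 ⦋n⦌)) ∈
          (Subcomplex.range e).obj (op ⦋n⦌) := by rw [h]; trivial
        have h₁ := ConcreteCategory.congr_hom (congr_app he _) y
        have h₂ : (stdSimplex.objEquiv.{u} (m := op ⦋n⦌)).symm (SimplexCategory.δ i) = y.1 := by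
          refine Eq.trans ?_ h₁
          refine Eq.trans ?_ (congr_arg ((stdSimplex.δ i).app _) hy.symm)
          rfl
        rw [h₂]
        exact y.2.2
      exact (subcomplex_le_horn_iff.{u} _ i).1 le_rfl h'
    have fac : e = Subcomplex.lift e this ≫ ∂Δ[n].ι := rfl
    rw [fac, comp_whiskerRight_assoc, hA, comp_const]
  obtain ⟨G, hG₁, hG₂⟩ := po.exists_desc
    ((stdSimplex.faceSingletonComplIso i).inv ▷ Δ[1] ≫ A) (SSet.const x) (by
      dsimp
      rw [← comp_whiskerRight_assoc, hb]
      rw [Category.assoc, ← stdSimplex.faceSingletonComplIso_hom_ι, Iso.inv_hom_id_assoc]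
      rfl)
  refine ⟨G, ?_, hG₂⟩
  dsimp at hG₁
  rw [← cancel_epi ((stdSimplex.faceSingletonComplIso i).inv ▷ Δ[1]), ← hG₁,
    ← comp_whiskerRight_assoc, boundary.faceSingletonComplIso_inv_ι]
  rfl

end horn

/-! ### Connected components as homotopy classes in degree 0 -/

lemma const_app_zero (y : Y _⦋0⦌) (x : X _⦋0⦌) : (const y : X ⟶ Y).app _ x = y := by
  have h : SimplexCategory.const ⦋0⦌ ⦋0⦌ 0 = 𝟙 _ := by ext k; fin_cases k; rfl
  change Y.map (SimplexCategory.const ⦋0⦌ ⦋0⦌ 0).op y = y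
  rw [h]
  simp

/-- Maps out of `Δ[0]` are relative morphisms, as the boundary of `Δ[0]` is empty. -/
def PtSimplex.ofVertex (x y : X _⦋0⦌) : X.PtSimplex 0 x where
  map := const y
  comm := boundary.hom_ext₀

lemma map_eq_const (s : Δ[0] ⟶ X) : s = const (yonedaEquiv s) := by
  rw [← yonedaEquiv_symm_zero, Equiv.symm_apply_apply]

lemma nonempty_edge_of_homotopy {a b : X _⦋0⦌} (h : Δ[0] ⊗ Δ[1] ⟶ X)
    (h₀ : ι₀ ≫ h = const a) (h₁ : ι₁ ≫ h = const b) : Nonempty (Edge a b) := by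
  let q : Δ[1] ⟶ Δ[0] ⊗ Δ[1] := lift (const (stdSimplex.obj₀Equiv.symm 0)) (𝟙 _)
  have q₀ : stdSimplex.δ 1 ≫ q = ι₀ :=
    CartesianMonoidalCategory.hom_ext _ _ stdSimplex.ext₀ stdSimplex.δ_one_eq_const
  have q₁ : stdSimplex.δ 0 ≫ q = ι₁ :=
    CartesianMonoidalCategory.hom_ext _ _ stdSimplex.ext₀ stdSimplex.δ_zero_eq_const
  refine ⟨Edge.mk (yonedaEquiv (q ≫ h)) ?_ ?_⟩
  · rw [← stdSimplex.yonedaEquiv_δ_comp, reassoc_of% q₀, h₀, yonedaEquiv_const]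
  · rw [← stdSimplex.yonedaEquiv_δ_comp, reassoc_of% q₁, h₁, yonedaEquiv_const]

lemma exists_homotopy_of_edge {a b : X _⦋0⦌} (e : Edge a b) :
    ∃ h : Δ[0] ⊗ Δ[1] ⟶ X, ι₀ ≫ h = const a ∧ ι₁ ≫ h = const b := by
  have p₀ : ι₀ ≫ snd Δ[0] Δ[1] = stdSimplex.{u}.δ 1 := stdSimplex.δ_one_eq_const.symm
  have p₁ : ι₁ ≫ snd Δ[0] Δ[1] = stdSimplex.{u}.δ 0 := stdSimplex.δ_zero_eq_const.symm
  refine ⟨snd _ _ ≫ yonedaEquiv.symm e.edge, ?_, ?_⟩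
  · rw [reassoc_of% p₀, stdSimplex.δ_comp_yonedaEquiv_symm, e.src_eq, yonedaEquiv_symm_zero]
  · rw [reassoc_of% p₁, stdSimplex.δ_comp_yonedaEquiv_symm, e.tgt_eq, yonedaEquiv_symm_zero]

namespace HomotopyGroup

/-- The comparison map from `π_0(X, x)` to the set of connected components. -/
def toπ₀ (x : X _⦋0⦌) : HomotopyGroup 0 X x → π₀ X :=
  Quot.lift (fun s ↦ π₀.mk (yonedaEquiv s.map)) (by
    rintro s t ⟨h⟩
    obtain ⟨e⟩ := nonempty_edge_of_homotopy h.h (h.h₀.trans (map_eq_const _))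
      (h.h₁.trans (map_eq_const _))
    exact π₀.sound e)

/-- The comparison map from the set of connected components to `π_0(X, x)`. -/
def ofπ₀ (x : X _⦋0⦌) : π₀ X → HomotopyGroup 0 X x :=
  π₀.lift (fun y ↦ (PtSimplex.ofVertex x y).homotopyClass) (by
    intro a b e
    obtain ⟨h, h₀, h₁⟩ := exists_homotopy_of_edge e
    exact RelativeMorphism.Homotopy.eq
      ⟨h, h₀, h₁, by ext _ ⟨⟨y, hy⟩, _⟩; simp at hy⟩)

lemma toπ₀_bijective (x : X _⦋0⦌) : Function.Bijective (toπ₀ x) := by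
  refine Function.bijective_iff_has_inverse.2 ⟨ofπ₀ x, ?_, ?_⟩
  · rintro ⟨s⟩
    refine congr_arg (Quot.mk _) ?_
    ext1
    exact (map_eq_const s.map).symm
  · intro y
    induction y with | _ y
    exact congr_arg π₀.mk (yonedaEquiv_const y)

lemma toπ₀_map (f : X ⟶ Y) (x : X _⦋0⦌) (s : HomotopyGroup 0 X x) :
    toπ₀ _ (map 0 f x s) = mapπ₀ f (toπ₀ x s) := by
  obtain ⟨s⟩ := s
  rfl

end HomotopyGroup

/-- Degree 0 reduces to `π₀`: as `∂Δ[0]` is empty, the relative condition is vacuous and the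
basepoint plays no role. -/
lemma IsHomotopyGroupEquiv.bijective {f : X ⟶ Y} (hf : IsHomotopyGroupEquiv f) (n : ℕ)
    (x : X _⦋0⦌) : Function.Bijective (HomotopyGroup.map n f x) := by
  obtain _ | n := n
  · rw [← (HomotopyGroup.toπ₀_bijective _).of_comp_iff']
    have : HomotopyGroup.toπ₀ _ ∘ HomotopyGroup.map 0 f x =
        mapπ₀ f ∘ HomotopyGroup.toπ₀ x := by
      ext s; exact HomotopyGroup.toπ₀_map f x s
    rw [this]
    exact hf.bijective_π₀.comp (HomotopyGroup.toπ₀_bijective x)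
  · exact hf.bijective_map _ (by omega) x

/-! ### Lifting against boundary inclusions -/

lemma PtSimplex.boundary_ι_map {n : ℕ} {x : X _⦋0⦌} (s : X.PtSimplex n x) :
    ∂Δ[n].ι ≫ s.map = const x := by
  rw [s.comm]; rfl

lemma PtSimplex.boundary_ι_homotopy {n : ℕ} {x : X _⦋0⦌} {s t : X.PtSimplex n x}
    (h : RelativeMorphism.Homotopy s t) :
    ∂Δ[n].ι ▷ Δ[1] ≫ h.h = const x := by
  rw [h.rel]; rfl

/-- The relative homotopy lifting property, when the boundary is sent to a point. -/
lemma IsHomotopyGroupEquiv.nonempty_relHomotopyLifting_of_const [KanComplex Y] {f : X ⟶ Y}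
    (hf : IsHomotopyGroupEquiv f) {n : ℕ} (x : X _⦋0⦌) (g : (∂Δ[n] : SSet) ⟶ X) (h : Δ[n] ⟶ Y)
    (hg : g = const x)
    (hgh : g ≫ f = ∂Δ[n].ι ≫ h) : Nonempty (RelHomotopyLifting ∂Δ[n].ι f g h) := by
  subst hg
  rw [const_comp] at hgh
  let t : Y.PtSimplex n (f.app _ x) := ⟨h, hgh.symm⟩
  obtain ⟨⟨s⟩, hs⟩ := (hf.bijective n x).2 t.homotopyClass
  obtain ⟨H⟩ := RelativeMorphism.nonempty_homotopy_of_homotopyClass_eq hs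
  refine ⟨⟨s.map, PtSimplex.boundary_ι_map s, H.h, H.h₀, H.h₁, ?_⟩⟩
  rw [PtSimplex.boundary_ι_homotopy H, ← hgh, comp_const]

/-- The `i`th face of a map on `∂Δ[n + 1]` which is constant on `Λ[n + 1, i]`. -/
def PtSimplex.ofBoundary {n : ℕ} {x : X _⦋0⦌} (i : Fin (n + 2)) (g : (∂Δ[n + 1] : SSet) ⟶ X)
    (hg : Subcomplex.homOfLE (horn.le_boundary i) ≫ g = const x) : X.PtSimplex n x where
  map := boundary.ι i ≫ g
  comm := by
    have fac : ∂Δ[n].ι ≫ boundary.ι i =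
        horn.boundaryFace i ≫ Subcomplex.homOfLE (horn.le_boundary i) := rfl
    rw [reassoc_of% fac, hg]
    rfl

/-- A map of Kan complexes inducing bijections on homotopy groups has the relative homotopy
lifting property with respect to boundary inclusions. -/
lemma IsHomotopyGroupEquiv.hasRHLP_boundary [KanComplex X] [KanComplex Y] {f : X ⟶ Y}
    (hf : IsHomotopyGroupEquiv f) (n : ℕ) : HasRHLP ∂Δ[n].ι f := by
  intro g h hgh
  obtain _ | n := n
  -- Surjectivity on `π₀` serves here only to produce a vertex of `X`; any `g` on the empty boundary
  -- is constant at it.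
  · obtain ⟨x, -⟩ := hf.bijective_π₀.2 (π₀.mk (yonedaEquiv h))
    obtain ⟨x, rfl⟩ := π₀.mk_surjective x
    exact hf.nonempty_relHomotopyLifting_of_const x g h boundary.hom_ext₀ hgh
  -- deform `g` so that it becomes constant on the last horn
  let j := Subcomplex.homOfLE (horn.le_boundary.{u} (Fin.last (n + 1)))
  have : Mono j := inferInstanceAs (Mono (Subcomplex.homOfLE _))
  let v : (Δ[n + 1] : SSet.{u}) _⦋0⦌ := stdSimplex.obj₀Equiv.symm (Fin.last (n + 1))
  have hv : v ∈ Λ[n + 1, Fin.last (n + 1)].obj _ := by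
    rw [mem_horn_iff_notMem_range]
    refine ⟨0, (Fin.last_pos).ne, ?_⟩
    rintro ⟨k, hk⟩
    exact (Fin.last_pos).ne hk.symm
  let v' : (Λ[n + 1, Fin.last (n + 1)] : SSet.{u}) _⦋0⦌ := ⟨v, hv⟩
  let x : X _⦋0⦌ := (j ≫ g).app _ v'
  have hc₀ : ι₀ ≫ horn.contraction n = 𝟙 _ := by
    rw [← cancel_mono (Subcomplex.ι _), Category.assoc, horn.contraction_ι, ι₀_comp_assoc,
      stdSimplex.ι₀_contraction, Category.comp_id, Category.id_comp]
  have hc₁ : ι₁ ≫ horn.contraction n = const v' := by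
    rw [← cancel_mono (Subcomplex.ι _), Category.assoc, horn.contraction_ι, ι₁_comp_assoc,
      stdSimplex.ι₁_contraction, comp_const, const_comp]
    rfl
  obtain ⟨G, hG, hG'⟩ := exists_homotopy_extension₀ j g (horn.contraction n ≫ j ≫ g)
    (by rw [reassoc_of% hc₀])
  obtain ⟨H, rfl, hH⟩ := exists_homotopy_extension₀ ∂Δ[n + 1].ι h (G ≫ f)
    (by rw [reassoc_of% hG, hgh])
  subst hG
  apply nonempty_relHomotopyLifting_of_homotopy _ _ _ _ hH
  have hgh' : (ι₁ ≫ G) ≫ f = ∂Δ[n + 1].ι ≫ ι₁ ≫ H := by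
    rw [← ι₁_comp_assoc, hH, Category.assoc]
  have hg' : j ≫ ι₁ ≫ G = const x := by
    rw [← ι₁_comp_assoc, hG', reassoc_of% hc₁, const_comp]
  clear_value x
  generalize ι₁ ≫ G = g' at *
  generalize ι₁ ≫ H = h' at *
  clear hH hG' hgh G H
  -- the restriction of `g'` to the last face is null homotopic
  let α : X.PtSimplex n x := PtSimplex.ofBoundary (Fin.last _) g' hg'
  obtain ⟨A⟩ : Nonempty (RelativeMorphism.Homotopy α (RelativeMorphism.const)) := by
    apply RelativeMorphism.nonempty_homotopy_of_homotopyClass_eq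
    apply (hf.bijective n x).1
    apply RelativeMorphism.Homotopy.eq
    -- The last face is contracted through `Δ[n + 1]` and mapped by `h'`. Its boundary moves inside
    -- the horn, where `h'` is constant, so the homotopy is relative.
    refine ⟨stdSimplex.δ (Fin.last _) ▷ Δ[1] ≫ stdSimplex.contraction (n + 1) ≫ h', ?_, ?_, ?_⟩
    · rw [ι₀_comp_assoc, ← Category.assoc ι₀, stdSimplex.ι₀_contraction, Category.id_comp]
      exact (boundary.ι (Fin.last _) ≫= hgh').symm
    · rw [ι₁_comp_assoc, ← Category.assoc ι₁, stdSimplex.ι₁_contraction, const_comp, comp_const]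
      refine Eq.trans (congr_arg const ?_) (const_comp x f).symm
      have h₁ := ConcreteCategory.congr_hom (congr_app (j ≫= hgh') _) v'
      have h₂ := ConcreteCategory.congr_hom (congr_app (hg' =≫ f) _) v'
      refine h₁.symm.trans (h₂.trans ?_)
      rw [const_comp]
      exact const_app_zero _ _
    · have fac : ∂Δ[n].ι ▷ Δ[1] ≫ stdSimplex.δ (Fin.last (n + 1)) ▷ Δ[1] ≫
          stdSimplex.contraction (n + 1) =
          horn.boundaryFace (Fin.last (n + 1)) ▷ Δ[1] ≫ horn.contraction n ≫ j ≫
            ∂Δ[n + 1].ι := rfl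
      rw [reassoc_of% fac, ← hgh', reassoc_of% hg', const_comp]
      rfl
  -- Extended by the constant homotopy on the horn, `A` deforms all of `g'` to the constant map.
  obtain ⟨G, hG, hG'⟩ := horn.exists_homotopy_boundary (Fin.last _) x A.h (PtSimplex.boundary_ι_homotopy A)
  have hG₀ : ι₀ ≫ G = g' := by
    refine horn.boundary_hom_ext (Fin.last _) ?_ ?_
    · rw [← ι₀_comp_assoc, hG, A.h₀]
      rfl
    · rw [← ι₀_comp_assoc, hG', comp_const]
      exact hg'.symm
  have hG₁ : ι₁ ≫ G = const x := by
    refine horn.boundary_hom_ext (Fin.last _) ?_ ?_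
    · rw [← ι₁_comp_assoc, hG, A.h₁]
      rfl
    · rw [← ι₁_comp_assoc, hG', comp_const, comp_const]
  obtain ⟨H, rfl, hH⟩ := exists_homotopy_extension₀ ∂Δ[n + 1].ι h' (G ≫ f)
    (by rw [reassoc_of% hG₀, hgh'])
  subst hG₀
  apply nonempty_relHomotopyLifting_of_homotopy _ _ _ _ hH
  exact hf.nonempty_relHomotopyLifting_of_const x _ _ hG₁
    (by rw [← ι₁_comp_assoc, hH, Category.assoc])

end SSet

theorem theorem5p2 {X Y : SSet.{u}} [SSet.KanComplex X] [SSet.KanComplex Y] (f : X ⟶ Y)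
    (hf : SSet.IsHomotopyGroupEquiv f) (n : ℕ) :
    SSet.HasRHLP (SSet.boundary.{u} n).ι f :=
  hf.hasRHLP_boundary n
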